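/- Let $A$ be a unital commutative real algebra. For a subalgebra $S\subseteq A$ (including $S=A$) let $X(S)$ be the set of unital $\mathbb R$-algebra homomorphisms $S\to\mathbb R$ with the weakest topology making every $\hat a:X(S)\to\mathbb R$, $\hat a(\alpha)=\alpha(a)$, $a\in S$, continuous. For subalgebras $S\subseteq T$ let $\pi_{S,T}:X(T)\to X(S)$ be the restriction map, and put $\pi_S=\pi_{S,A}$. Let $I$ (resp. $\Lambda$) be the set of all finitely (resp. countably) generated subalgebras of $A$, and let $\Sigma_I$ be the smallest $\sigma$-algebra on $X(A)$ for which every $\pi_S:X(A)\to X(S)$, $S\in I$, is measurable with respect to the Borel $\sigma$-algebra of $X(S)$. A Radon measure is a Borel measure that is locally finite and inner regular on Borel sets with respect to compact sets. A measure $\nu$ on a $\sigma$-algebra $\Sigma$ on $X(S)$ is supported in $K\in\Sigma$ if $\nu(X(S)\setminus K)=0$; it is a $K$-representing measure for a linear functional $\ell:S\to\mathbb R$ if it is supported in $K$ and, for all $a\in S$, $\hat a$ is $\nu$-integrable and $\ell(a)=\int\hat a\,d\nu$. A family $(\mu_S)$ of Borel measures on $X(S)$, indexed by $S\in I$ or by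 $S\in\Lambda$, is exact if $(\pi_{S,T})_{\#}\mu_T=\mu_S$ for all $S\subseteq T$ in the index set; an exact family is thick if, for every index $S$, $\mu_S(M)=0$ for each Borel $M\subseteq X(S)$ with $M\cap\pi_S(X(A))=\emptyset$. For an exact family $(\mu_S)_{S\in I}$ of Radon probability measures, the corresponding exact family $(\mu_T)_{T\in\Lambda}$ consists of the Radon probability measures $\mu_T$ on $X(T)$ with $(\pi_{S,T})_{\#}\mu_T=\mu_S$ for all $S\in I$ with $S\subseteq T$. A family $(\mu_S)_{S\in I}$ satisfies Prokhorov's condition if for every $\varepsilon>0$ there is a compact $C_\varepsilon\subseteq X(A)$ with $\mu_S(\pi_S(C_\varepsilon))\ge 1-\varepsilon$ for all $S\in I$. **Theorem.** Let $L:A\to\mathbb R$ be linear with $L(1)=1$, let $K\subseteq X(A)$ be closed, and suppose that $L(a)\ge 0$ for every $a\in A$ with $\hat a\ge 0$ on $K$. Then: (i) For each $S\in I$ there exists a $\overline{\pi_S(K)}$-representing Radon measure for $L|_S$. (ii) There exists an $X(A)$-representing measure $\mu$ for $L$ on $\Sigma_I$ that is supported in $\pi_S^{-1}(\overline{\pi_S(K)})$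 for each $S\in I$ if and only if one can choose, for each $S\in I$, a $\overline{\pi_S(K)}$-representing Radon measure $\mu_S$ for $L|_S$ such that $(\mu_S)_{S\in I}$ is exact and the corresponding exact family $(\mu_T)_{T\in\Lambda}$ is thick. Moreover, if $K=\{\alpha\in X(A):\alpha(a)\ge 0\text{ for all }a\in Q\}$ for some quadratic module $Q$ of $A$ that is generated by a countable set (a quadratic module is a subset $Q$ with $1\in Q$, $Q+Q\subseteq Q$ and $a^2Q\subseteq Q$ for all $a\in A$), then $K\in\Sigma_I$ and every such $\mu$ is a $K$-representing measure for $L$ on $\Sigma_I$. (iii) There exists a $K$-representing Radon measure for $L$ on the Borel $\sigma$-algebra of $X(A)$ if and only if one can choose, for each $S\in I$, a $\overline{\pi_S(K)}$-representing Radon measure $\mu_S$ for $L|_S$ such that $(\mu_S)_{S\in I}$ satisfies Prokhorov's condition. -/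

import Mathlib

open MeasureTheory

namespace Moment

/-- The character space `X(A)`: the unital homomorphisms `A → ℝ`. -/
def CharSpace (A : Type*) [CommRing A] [Algebra ℝ A] : Type _ := A →ₐ[ℝ] ℝ

section CharSpace

variable {A : Type*} [CommRing A] [Algebra ℝ A]

/-- The function `â : X(A) → ℝ`, `â(α) = α(a)`. -/
def gelfand (a : A) (α : CharSpace A) : ℝ := (show A →ₐ[ℝ] ℝ from α) a

/-- The weakest topology on `X(A)` making every `â` continuous, i.e. the topology induced by
the embedding of `X(A)` in the product `ℝ^A`. -/
instance : TopologicalSpace (CharSpace A) :=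
  TopologicalSpace.induced (fun (α : CharSpace A) (a : A) => gelfand a α) Pi.topologicalSpace

/-- By default `X(A)` carries its Borel σ-algebra. -/
instance : MeasurableSpace (CharSpace A) := borel (CharSpace A)

instance : BorelSpace (CharSpace A) := ⟨rfl⟩

/-- The restriction map `π_S : X(A) → X(S)`. -/
def restrict (S : Subalgebra ℝ A) (α : CharSpace A) : CharSpace S :=
  AlgHom.comp (show A →ₐ[ℝ] ℝ from α) S.val

/-- The restriction map `π_{S,T} : X(T) → X(S)` for subalgebras `S ⊆ T`. -/
def restrictLE {S T : Subalgebra ℝ A} (h : S ≤ T) (α : CharSpace T) : CharSpace S :=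
  AlgHom.comp (show T →ₐ[ℝ] ℝ from α) (Subalgebra.inclusion h)

theorem continuous_gelfand (a : A) : Continuous (gelfand (A := A) a) :=
  (continuous_apply a).comp continuous_induced_dom

theorem continuous_restrict (S : Subalgebra ℝ A) : Continuous (restrict S) :=
  continuous_induced_rng.2 (continuous_pi fun a => continuous_gelfand (a : A))

theorem continuous_restrictLE {S T : Subalgebra ℝ A} (h : S ≤ T) :
    Continuous (restrictLE h) :=
  continuous_induced_rng.2
    (continuous_pi fun a => continuous_gelfand (Subalgebra.inclusion h a))

theorem measurable_restrictLE {S T : Subalgebra ℝ A} (h : S ≤ T) :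
    Measurable (restrictLE h) :=
  (continuous_restrictLE h).measurable

/-- The set `Pos_A(K)` of the `a ∈ A` with `â ≥ 0` on `K`. -/
def Pos (K : Set (CharSpace A)) : Set A := {a | ∀ α ∈ K, 0 ≤ gelfand a α}

/-- The set `K_Q` of the characters that are non-negative on `Q`. -/
def nonnegSet (Q : Set A) : Set (CharSpace A) := {α | ∀ a ∈ Q, 0 ≤ gelfand a α}

/-- A Radon measure: locally finite, and inner regular on all Borel sets with respect to
compact subsets. -/
structure IsRadon {X : Type*} [TopologicalSpace X] [MeasurableSpace X] (μ : Measure X) :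
    Prop where
  locallyFinite : IsLocallyFiniteMeasure μ
  innerRegular : μ.InnerRegular

/-- `ν`, a measure on the σ-algebra `m` on `X(A)`, is a `K`-representing measure for `L`:
`K` belongs to `m`, `ν` is supported in `K`, and `L(a) = ∫ â dν` for all `a`, where every `â`
is `ν`-integrable. -/
structure IsRepresenting {m : MeasurableSpace (CharSpace A)} (L : A →ₗ[ℝ] ℝ)
    (K : Set (CharSpace A)) (ν : Measure[m] (CharSpace A)) : Prop where
  measurableSet : MeasurableSet[m] K
  supported : ν Kᶜ = 0
  integrable : ∀ a : A, Integrable (gelfand a) ν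
  eq_integral : ∀ a : A, L a = ∫ α, gelfand a α ∂ν

/-- A `K`-representing Radon measure on the Borel σ-algebra of `X(A)`. -/
structure IsRepresentingRadon (L : A →ₗ[ℝ] ℝ) (K : Set (CharSpace A))
    (ν : Measure (CharSpace A)) : Prop where
  representing : IsRepresenting L K ν
  radon : IsRadon ν

/-- The restriction of the linear functional `L` to the subalgebra `S`. -/
def restrictFunctional (L : A →ₗ[ℝ] ℝ) (S : Subalgebra ℝ A) : S →ₗ[ℝ] ℝ :=
  L ∘ₗ S.val.toLinearMap

end CharSpace

section Systems

variable (A : Type*) [CommRing A] [Algebra ℝ A]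

/-- The index set `I` of the finitely generated subalgebras of `A`, ordered by inclusion. -/
abbrev FinGen := {S : Subalgebra ℝ A // S.FG}

/-- The index set `Λ` of the countably generated subalgebras of `A`, ordered by inclusion. -/
abbrev CountGen :=
  {T : Subalgebra ℝ A // ∃ G : Set A, G.Countable ∧ Algebra.adjoin ℝ G = T}

/-- The cylinder σ-algebra `Σ_I` on `X(A)`: the smallest one for which all the maps
`π_S : X(A) → X(S)`, with `S` a finitely generated subalgebra, are measurable. -/
abbrev sigmaCyl : MeasurableSpace (CharSpace A) :=
  ⨆ S : FinGen A, MeasurableSpace.comap (restrict S.1) (borel (CharSpace S.1))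

variable {A}

/-- Exactness of a family of Borel measures on the spaces `X(S)`, with `S` in a class `P` of
subalgebras: the push-forward of `μ_T` under `π_{S,T}` is `μ_S` whenever `S ⊆ T`. -/
def IsExact {P : Subalgebra ℝ A → Prop} (μ : (S : Subtype P) → Measure (CharSpace S.1)) : Prop :=
  ∀ (S T : Subtype P) (h : S.1 ≤ T.1), (μ T).map (restrictLE h) = μ S

/-- Thickness: `π_S(X(A))` is thick with respect to `μ_S`, for every `S` in the class. -/
def IsThick {P : Subalgebra ℝ A → Prop} (μ : (S : Subtype P) → Measure (CharSpace S.1)) : Prop :=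
  ∀ (S : Subtype P) (M : Set (CharSpace S.1)), MeasurableSet M →
    Set.range (restrict S.1) ∩ M = ∅ → μ S M = 0

/-- `μ'` is the system on the countably generated subalgebras that corresponds to the system `μ`
on the finitely generated ones: every `μ'_T` is a Radon probability measure on `X(T)` whose
push-forward under `π_{S,T}` is `μ_S`, for all finitely generated `S ⊆ T`. -/
structure Corresponds (μ : (S : FinGen A) → Measure (CharSpace S.1))
    (μ' : (T : CountGen A) → Measure (CharSpace T.1)) : Prop where
  radon : ∀ T, IsRadon (μ' T)
  prob : ∀ T, IsProbabilityMeasure (μ' T)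
  map_eq : ∀ (S : FinGen A) (T : CountGen A) (h : S.1 ≤ T.1), (μ' T).map (restrictLE h) = μ S

/-- Prokhorov's condition. -/
def Prokhorov (μ : (S : FinGen A) → Measure (CharSpace S.1)) : Prop :=
  ∀ ε : ℝ, 0 < ε → ∃ C : Set (CharSpace A), IsCompact C ∧
    ∀ S : FinGen A, ENNReal.ofReal (1 - ε) ≤ μ S (restrict S.1 '' C)

/-- Quadratic modules of `A`. -/
structure IsQuadraticModule (Q : Set A) : Prop where
  one_mem : (1 : A) ∈ Q
  add_mem : ∀ a ∈ Q, ∀ b ∈ Q, a + b ∈ Q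
  sq_mul_mem : ∀ a : A, ∀ b ∈ Q, a ^ 2 * b ∈ Q

/-- `Q` is the quadratic module generated by `G`. -/
def IsGeneratedBy (Q G : Set A) : Prop :=
  IsLeast {P : Set A | IsQuadraticModule P ∧ G ⊆ P} Q

end Systems

end Moment

/-! Part (i) is Haviland's theorem. Suppose some `p̂` is proper on the closed set `K`. By M. Riesz
extension, `L` extends to a positive functional on `A × C_c(K)`, and Riesz-Markov turns its second
component into a measure on `K`. Cutting `â` off outside `|p̂| ≤ n` costs at most `(1 + â²) p̂² /
n²`, so the measure represents `L` (`exists_representing_of_proper`). On a finitely generated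
algebra the sum of the squares of the generators is proper.

Part (ii) rests on two facts about countably generated `T`: the space `X(T)` is Polish, and every
set of the cylinder σ-algebra is pulled back from a single `X(T)`. Thickness says that `μ_T(M)`
depends only on the preimage of `M` in `X(A)`, so the `μ_T` define a set function on the cylinder
σ-algebra. It is σ-additive because countably many `T` have a common upper bound
(`exists_measure_of_isThick`). Conversely, push-forwards of a measure on `X(A)` ignore sets that
miss the image of `X(A)`. For a countably generated `Q`, the set `K` is a countable intersection of
sets `{â ≥ 0}`, each visible on a finitely generated subalgebra.

In part (iii) the `μ_S` need not be compatible, so limits are taken of functionals instead of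
measures. The compact sets from Prokhorov's condition cut each `X(S)` into shells, the `n`-th one
inside `π_S(C n)`. Ultrafilter limits over `S` of the integrals over the `n`-th shell give a
functional `Φ n` on `A`, which is nonnegative on `Pos (C n ∩ K)` (`limitFunctional_nonneg`).
Haviland on this compact set represents `Φ n`. A uniform tail estimate shows that the `Φ n` sum to
`L`, so the sum of the measures represents `L` (`exists_representing_of_prokhorov`). -/

namespace Moment

open Topology Filter Set

/-! ### Topology of the character space -/

section Topology

variable {A : Type*} [CommRing A] [Algebra ℝ A]

@[simp] theorem gelfand_add (a b : A) (α : CharSpace A) :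
    gelfand (a + b) α = gelfand a α + gelfand b α := map_add (show A →ₐ[ℝ] ℝ from α) a b

@[simp] theorem gelfand_mul (a b : A) (α : CharSpace A) :
    gelfand (a * b) α = gelfand a α * gelfand b α := map_mul (show A →ₐ[ℝ] ℝ from α) a b

@[simp] theorem gelfand_pow (a : A) (n : ℕ) (α : CharSpace A) :
    gelfand (a ^ n) α = gelfand a α ^ n := map_pow (show A →ₐ[ℝ] ℝ from α) a n

@[simp] theorem gelfand_smul (r : ℝ) (a : A) (α : CharSpace A) :
    gelfand (r • a) α = r * gelfand a α := map_smul (show A →ₐ[ℝ] ℝ from α) r a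

@[simp] theorem gelfand_neg (a : A) (α : CharSpace A) :
    gelfand (-a) α = -gelfand a α := map_neg (show A →ₐ[ℝ] ℝ from α) a

@[simp] theorem gelfand_sub (a b : A) (α : CharSpace A) :
    gelfand (a - b) α = gelfand a α - gelfand b α := map_sub (show A →ₐ[ℝ] ℝ from α) a b

@[simp] theorem gelfand_zero (α : CharSpace A) : gelfand (0 : A) α = 0 :=
  map_zero (show A →ₐ[ℝ] ℝ from α)

@[simp] theorem gelfand_one (α : CharSpace A) : gelfand (1 : A) α = 1 :=
  map_one (show A →ₐ[ℝ] ℝ from α)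

@[simp] theorem gelfand_algebraMap (r : ℝ) (α : CharSpace A) :
    gelfand (algebraMap ℝ A r) α = r := (show A →ₐ[ℝ] ℝ from α).commutes r

@[simp] theorem gelfand_sum {ι : Type*} (s : Finset ι) (f : ι → A) (α : CharSpace A) :
    gelfand (∑ i ∈ s, f i) α = ∑ i ∈ s, gelfand (f i) α := map_sum (show A →ₐ[ℝ] ℝ from α) f s

theorem charSpace_ext {α β : CharSpace A} (h : ∀ a, gelfand a α = gelfand a β) : α = β :=
  AlgHom.ext h

theorem isEmbedding_gelfand :
    IsEmbedding (fun (α : CharSpace A) (a : A) => gelfand a α) :=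
  ⟨⟨rfl⟩, fun _ _ h => charSpace_ext fun a => congrFun h a⟩

instance : T2Space (CharSpace A) := isEmbedding_gelfand.t2Space

/-- The image is cut out of `ℝ^A` by the identities of a unital algebra homomorphism, and each of
them is a closed condition on finitely many coordinates. -/
theorem isClosedEmbedding_gelfand :
    IsClosedEmbedding (fun (α : CharSpace A) (a : A) => gelfand a α) := by
  refine ⟨isEmbedding_gelfand, ?_⟩
  have h : range (fun (α : CharSpace A) (a : A) => gelfand a α) =
      {x : A → ℝ | (∀ a b, x (a + b) = x a + x b) ∧ (∀ a b, x (a * b) = x a * x b) ∧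
        ∀ r : ℝ, x (algebraMap ℝ A r) = r} := by
    ext x
    constructor
    · rintro ⟨α, rfl⟩
      simp
    · rintro ⟨h1, h2, h3⟩
      refine ⟨(AlgHom.mk ⟨⟨⟨x, by simpa using h3 1⟩, h2⟩, by simpa using h3 0, h1⟩ h3 :
        A →ₐ[ℝ] ℝ), rfl⟩
  rw [h]
  simp only [ofPred_and, ofPred_forall]
  refine IsClosed.inter ?_ (IsClosed.inter ?_ ?_)
  · exact isClosed_iInter fun a => isClosed_iInter fun b => isClosed_eq (by fun_prop) (by fun_prop)
  · exact isClosed_iInter fun a => isClosed_iInter fun b => isClosed_eq (by fun_prop) (by fun_prop)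
  · exact isClosed_iInter fun a => isClosed_eq (by fun_prop) (by fun_prop)

/-- Tychonoff: such a set is a closed subset of the preimage of a product of compact intervals under
a closed embedding. -/
theorem isCompact_of_bounded {C : Set (CharSpace A)} (hC : IsClosed C)
    (h : ∀ a : A, ∃ M, ∀ α ∈ C, |gelfand a α| ≤ M) : IsCompact C := by
  choose M hM using h
  have hc : IsCompact (Set.pi univ fun a => Icc (-M a) (M a)) :=
    isCompact_univ_pi fun a => isCompact_Icc
  exact (isClosedEmbedding_gelfand.isCompact_preimage hc).of_isClosed_subset hC
    fun α hα a _ => abs_le.1 (hM a α hα)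

theorem exists_bound_of_adjoin {G : Set A} {C : Set (CharSpace A)}
    (h : ∀ a ∈ G, ∃ M, ∀ α ∈ C, |gelfand a α| ≤ M) {a : A} (ha : a ∈ Algebra.adjoin ℝ G) :
    ∃ M, ∀ α ∈ C, |gelfand a α| ≤ M := by
  induction ha using Algebra.adjoin_induction with
  | mem x hx => exact h x hx
  | algebraMap r => exact ⟨|r|, fun α _ => by simp⟩
  | add x y _ _ hx hy =>
    obtain ⟨M, hM⟩ := hx
    obtain ⟨N, hN⟩ := hy
    refine ⟨M + N, fun α hα => ?_⟩
    rw [gelfand_add]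
    exact (abs_add_le _ _).trans (add_le_add (hM α hα) (hN α hα))
  | mul x y _ _ hx hy =>
    obtain ⟨M, hM⟩ := hx
    obtain ⟨N, hN⟩ := hy
    refine ⟨M * N, fun α hα => ?_⟩
    rw [gelfand_mul, abs_mul]
    exact mul_le_mul (hM α hα) (hN α hα) (abs_nonneg _) ((abs_nonneg _).trans (hM α hα))

theorem isCompact_of_bounded_generators {G : Set A} (hG : Algebra.adjoin ℝ G = ⊤)
    {C : Set (CharSpace A)} (hC : IsClosed C)
    (h : ∀ a ∈ G, ∃ M, ∀ α ∈ C, |gelfand a α| ≤ M) : IsCompact C :=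
  isCompact_of_bounded hC fun a => exists_bound_of_adjoin h (a := a) (hG ▸ Algebra.mem_top)

theorem charSpace_ext_of_adjoin {G : Set A} (hG : Algebra.adjoin ℝ G = ⊤) {α β : CharSpace A}
    (h : ∀ a ∈ G, gelfand a α = gelfand a β) : α = β :=
  AlgHom.ext_of_adjoin_eq_top hG h

theorem isClosedEmbedding_generators {G : Set A} (hGc : G.Countable)
    (hG : Algebra.adjoin ℝ G = ⊤) :
    IsClosedEmbedding (fun (α : CharSpace A) (a : G) => gelfand (a : A) α) := by
  have hcont : Continuous (fun (α : CharSpace A) (a : G) => gelfand (a : A) α) :=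
    continuous_pi fun a => continuous_gelfand (a : A)
  have := hGc.to_subtype
  refine IsClosedEmbedding.of_continuous_injective_isClosedMap hcont
    (fun α β h => charSpace_ext_of_adjoin hG fun a ha => congrFun h ⟨a, ha⟩) ?_
  -- Countability of `G` makes `ℝ^G` metrizable, hence compactly generated, so properness can be
  -- tested on preimages of compact sets. These are bounded on the generators, hence on all of `A`.
  refine (isProperMap_iff_isCompact_preimage.2 ⟨hcont, fun C hC => ?_⟩).isClosedMap
  refine isCompact_of_bounded_generators hG (hC.isClosed.preimage hcont) fun a ha => ?_
  obtain ⟨M, hM⟩ := (hC.image (continuous_apply (⟨a, ha⟩ : G))).isBounded.exists_norm_le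
  exact ⟨M, fun α hα => hM _ ⟨_, hα, rfl⟩⟩

theorem measurable_of_generators {G : Set A} (hGc : G.Countable) (hG : Algebra.adjoin ℝ G = ⊤)
    {Ω : Type*} [MeasurableSpace Ω] {f : Ω → CharSpace A}
    (hf : ∀ a ∈ G, Measurable fun ω => gelfand a (f ω)) : Measurable f := by
  have := hGc.to_subtype
  rw [(isClosedEmbedding_generators hGc hG).measurableEmbedding.measurable_comp_iff.symm]
  exact measurable_pi_iff.2 fun a => hf a a.2

/-- As a closed subspace of `ℝ^G` with `G` countable, the character space is Polish, and finite
Borel measures on Polish spaces are inner regular. -/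
theorem innerRegular_of_generators {G : Set A} (hGc : G.Countable)
    (hG : Algebra.adjoin ℝ G = ⊤) (μ : Measure (CharSpace A)) [IsFiniteMeasure μ] :
    μ.InnerRegular := by
  have := hGc.to_subtype
  have := (isClosedEmbedding_generators hGc hG).polishSpace
  let := TopologicalSpace.upgradeIsCompletelyMetrizable (CharSpace A)
  infer_instance

end Topology

/-! ### Finitely and countably generated subalgebras -/

section Subalgebra

variable {A : Type*} [CommRing A] [Algebra ℝ A]

theorem adjoin_preimage_val {S : Subalgebra ℝ A} {G : Set A} (hG : Algebra.adjoin ℝ G = S) :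
    Algebra.adjoin ℝ ((↑) ⁻¹' G : Set S) = ⊤ := by
  subst hG
  exact Algebra.adjoin_adjoin_coe_preimage

theorem CountGen.exists_generators (T : CountGen A) :
    ∃ G : Set T.1, G.Countable ∧ Algebra.adjoin ℝ G = ⊤ := by
  obtain ⟨G, hGc, hG⟩ := T.2
  exact ⟨_, hGc.preimage Subtype.val_injective, adjoin_preimage_val hG⟩

theorem FinGen.exists_generators (S : FinGen A) :
    ∃ G : Finset S.1, Algebra.adjoin ℝ (G : Set S.1) = ⊤ := by
  classical
  obtain ⟨G, hG⟩ := S.2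
  refine ⟨G.preimage _ Subtype.val_injective.injOn, ?_⟩
  rw [Finset.coe_preimage]
  exact adjoin_preimage_val hG

/-- The finitely generated subalgebra generated by a finite set. -/
def FinGen.adjoin (G : Finset A) : FinGen A := ⟨Algebra.adjoin ℝ (G : Set A), G, rfl⟩

theorem FinGen.mem_adjoin {G : Finset A} {a : A} (ha : a ∈ G) : a ∈ (FinGen.adjoin G).1 :=
  Algebra.subset_adjoin ha

instance : Nonempty (FinGen A) := ⟨FinGen.adjoin ∅⟩

instance : IsDirectedOrder (FinGen A) :=
  ⟨fun S T => ⟨⟨S.1 ⊔ T.1, S.2.sup T.2⟩, le_sup_left (a := S.1), le_sup_right (a := S.1)⟩⟩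

/-- A finitely generated subalgebra is countably generated. -/
def FinGen.toCountGen (S : FinGen A) : CountGen A :=
  ⟨S.1, let ⟨G, hG⟩ := S.2; ⟨G, G.countable_toSet, hG⟩⟩

/-- A closed set of characters is determined by its projections to the character spaces of the
finitely generated subalgebras. -/
theorem mem_of_forall_restrict_mem_closure {K : Set (CharSpace A)} (hK : IsClosed K)
    {α : CharSpace A} (h : ∀ S : FinGen A, restrict S.1 α ∈ closure (restrict S.1 '' K)) :
    α ∈ K := by
  rw [← hK.closure_eq, mem_closure_iff_nhds]
  intro t ht
  rw [isEmbedding_gelfand.nhds_eq_comap, mem_comap] at ht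
  obtain ⟨u, hu, hut⟩ := ht
  -- A basic neighbourhood of `α` involves only a finite set `F` of elements of `A`, so it is
  -- already visible on the subalgebra generated by `F`.
  rw [nhds_pi, Filter.mem_pi'] at hu
  obtain ⟨F, v, hv, hvu⟩ := hu
  have hopen : ∀ a : F, gelfand (⟨a, FinGen.mem_adjoin a.2⟩ : (FinGen.adjoin F).1) ⁻¹' v a ∈
      𝓝 (restrict (FinGen.adjoin F).1 α) := fun a =>
    (continuous_gelfand _).continuousAt.preimage_mem_nhds (hv a)
  obtain ⟨_, hβ, β, hβK, rfl⟩ := mem_closure_iff_nhds.1 (h (FinGen.adjoin F)) _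
    (iInter_mem.2 hopen)
  exact ⟨β, hut (hvu fun a ha => mem_iInter.1 hβ ⟨a, ha⟩), hβK⟩

end Subalgebra

open scoped CompactlySupported

/-! ### Haviland's theorem -/

section Haviland

variable {A : Type*} [CommRing A] [Algebra ℝ A]

theorem isCompact_sublevel_subtype {K : Set (CharSpace A)} {p : A} {r : ℝ}
    (hp : IsCompact {α ∈ K | |gelfand p α| ≤ r}) : IsCompact {x : K | |gelfand p x.1| ≤ r} := by
  rw [Subtype.isCompact_iff]
  convert hp using 1
  ext α
  simp [and_comm]

theorem locallyCompactSpace_of_proper {K : Set (CharSpace A)} {p : A}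
    (hp : ∀ r : ℝ, IsCompact {α ∈ K | |gelfand p α| ≤ r}) : LocallyCompactSpace K := by
  have : WeaklyLocallyCompactSpace K := by
    refine ⟨fun x => ⟨_, isCompact_sublevel_subtype (hp (|gelfand p x.1| + 1)), ?_⟩⟩
    have hc : Continuous fun x : K => |gelfand p x.1| :=
      ((continuous_gelfand p).comp continuous_subtype_val).abs
    exact mem_of_superset (hc.continuousAt.eventually (gt_mem_nhds (lt_add_one _)))
      fun y (hy : |gelfand p y.1| < _) => hy.le
  infer_instance

/-- M. Riesz extension for the cone of pairs `(a, g)` with `â + g ≥ 0` on `K`. Working in the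
product, and not in a space of functions on `K`, avoids having to show that `L a` depends only on
`â` restricted to `K`. -/
theorem exists_positive_extension (L : A →ₗ[ℝ] ℝ) {K : Set (CharSpace A)}
    (hpos : ∀ a ∈ Pos K, 0 ≤ L a) :
    ∃ G : A × C_c(K, ℝ) →ₗ[ℝ] ℝ, (∀ a, G (a, 0) = L a) ∧
      ∀ a (g : C_c(K, ℝ)), (∀ x : K, 0 ≤ gelfand a x.1 + g x) → 0 ≤ G (a, g) := by
  let s : PointedCone ℝ (A × C_c(K, ℝ)) :=
    { carrier := {q | ∀ x : K, 0 ≤ gelfand q.1 x.1 + q.2 x}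
      add_mem' := fun {q r} hq hr x => by
        have := add_nonneg (hq x) (hr x)
        simp only [Prod.fst_add, Prod.snd_add, gelfand_add, CompactlySupportedContinuousMap.add_apply]
        linarith
      zero_mem' := fun x => by simp
      smul_mem' := fun c q hq x => by
        have := mul_nonneg c.2 (hq x)
        have h1 : (c • q).1 = (c : ℝ) • q.1 := rfl
        have h2 : (c • q).2 x = (c : ℝ) * q.2 x := rfl
        rw [h1, h2, gelfand_smul]
        linarith }
  let f : A × C_c(K, ℝ) →ₗ.[ℝ] ℝ :=
    { domain := Submodule.prod ⊤ ⊥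
      toFun := L ∘ₗ LinearMap.fst ℝ A C_c(K, ℝ) ∘ₗ Submodule.subtype _ }
  obtain ⟨G, hG, hGs⟩ := riesz_extension s f
    (by
      rintro ⟨⟨a, g⟩, hag⟩ h
      obtain rfl : g = 0 := hag.2
      exact hpos a fun α hα => by simpa using h ⟨α, hα⟩)
    (by
      rintro ⟨a, g⟩
      obtain ⟨M, hM⟩ := (g.hasCompactSupport.isCompact_range g.continuous).isBounded.exists_norm_le
      -- Adding this element of the domain to `(a, g)` leaves `M + g`, which is nonnegative because
      -- `M` bounds `|g|`.
      refine ⟨⟨(algebraMap ℝ A M - a, 0), trivial, rfl⟩, fun x => ?_⟩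
      have := abs_le.1 (hM _ (mem_range_self x))
      simp only [Prod.fst_add, Prod.snd_add, gelfand_add, gelfand_sub, gelfand_algebraMap, zero_add]
      linarith)
  exact ⟨G, fun a => hG ⟨(a, 0), trivial, rfl⟩, fun a g h => hGs (a, g) h⟩

/-- The continuous cutoff function that is `1` where `|p| ≤ n` and `0` where `|p| ≥ n + 1`. -/
noncomputable def cutoff (p : A) (n : ℕ) (α : CharSpace A) : ℝ :=
  max 0 (min 1 (n + 1 - |gelfand p α|))

theorem continuous_cutoff (p : A) (n : ℕ) : Continuous (cutoff p n) :=
  continuous_const.max (continuous_const.min (continuous_const.sub (continuous_gelfand p).abs))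

theorem cutoff_nonneg (p : A) (n : ℕ) (α : CharSpace A) : 0 ≤ cutoff p n α := le_max_left _ _

theorem cutoff_le_one (p : A) (n : ℕ) (α : CharSpace A) : cutoff p n α ≤ 1 :=
  max_le zero_le_one (min_le_left _ _)

theorem one_sub_cutoff_le (p : A) (n : ℕ) (α : CharSpace A) :
    (n : ℝ) ^ 2 * (1 - cutoff p n α) ≤ gelfand p α ^ 2 := by
  rcases le_total |gelfand p α| n with h | h
  · have : cutoff p n α = 1 := by
      rw [cutoff, min_eq_left (by linarith), max_eq_right zero_le_one]
    rw [this, sub_self, mul_zero]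
    positivity
  · have h2 := cutoff_nonneg p n α
    rw [← sq_abs (gelfand p α)]
    have : (n : ℝ) ^ 2 ≤ |gelfand p α| ^ 2 := pow_le_pow_left₀ n.cast_nonneg h 2
    nlinarith [sq_nonneg (n : ℝ)]

theorem tendsto_cutoff (p : A) (α : CharSpace A) :
    Tendsto (fun n => cutoff p n α) atTop (𝓝 1) := by
  refine tendsto_const_nhds.congr' ?_
  filter_upwards [eventually_ge_atTop ⌈|gelfand p α|⌉₊] with n hn
  have := Nat.ceil_le.1 hn
  rw [cutoff, min_eq_left (by linarith), max_eq_right zero_le_one]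

/-- The compactly supported truncation `â · χ_n` on `K`. -/
noncomputable def truncation {K : Set (CharSpace A)} {p : A}
    (hp : ∀ r : ℝ, IsCompact {α ∈ K | |gelfand p α| ≤ r}) (n : ℕ) (a : A) : C_c(K, ℝ) where
  toFun x := gelfand a x.1 * cutoff p n x.1
  continuous_toFun := ((continuous_gelfand a).mul (continuous_cutoff p n)).comp
    continuous_subtype_val
  hasCompactSupport' := HasCompactSupport.intro (isCompact_sublevel_subtype (hp (n + 1)))
    fun x hx => by
      have : (n : ℝ) + 1 < |gelfand p x.1| := not_le.1 hx
      rw [cutoff, min_eq_right (by linarith), max_eq_left (by linarith), mul_zero]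

theorem truncation_apply {K : Set (CharSpace A)} {p : A}
    (hp : ∀ r : ℝ, IsCompact {α ∈ K | |gelfand p α| ≤ r}) (n : ℕ) (a : A) (x : K) :
    truncation hp n a x = gelfand a x.1 * cutoff p n x.1 := rfl

/-- The bound `|â| (1 - χ_n) ≤ (1 + â²) p̂² / n²`. -/
theorem gelfand_sub_truncation_le (p : A) (n : ℕ) (a : A) (α : CharSpace A) :
    (n : ℝ) ^ 2 * (|gelfand a α| * (1 - cutoff p n α)) ≤ gelfand ((1 + a ^ 2) * p ^ 2) α := by
  have h1 := one_sub_cutoff_le p n α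
  have h2 : |gelfand a α| ≤ 1 + gelfand a α ^ 2 := by
    rw [← sq_abs]
    nlinarith [sq_nonneg (|gelfand a α| - 1), sq_nonneg (|gelfand a α|)]
  have h3 := cutoff_le_one p n α
  simp only [gelfand_mul, gelfand_add, gelfand_one, gelfand_pow]
  calc (n : ℝ) ^ 2 * (|gelfand a α| * (1 - cutoff p n α))
      = |gelfand a α| * ((n : ℝ) ^ 2 * (1 - cutoff p n α)) := by ring
    _ ≤ _ := mul_le_mul h2 h1 (mul_nonneg (sq_nonneg _) (by linarith)) (by positivity)

theorem abs_gelfand_le (a : A) (α : CharSpace A) : |gelfand a α| ≤ gelfand (1 + a ^ 2) α := by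
  rw [gelfand_add, gelfand_one, gelfand_pow, ← sq_abs]
  nlinarith [sq_nonneg (|gelfand a α| - 1), sq_nonneg (|gelfand a α|)]

/-- **Haviland's theorem** for a closed set on which some `p̂` is proper. -/
theorem exists_representing_of_proper (L : A →ₗ[ℝ] ℝ) {K : Set (CharSpace A)} (hK : IsClosed K)
    (hpos : ∀ a ∈ Pos K, 0 ≤ L a) {p : A}
    (hp : ∀ r : ℝ, IsCompact {α ∈ K | |gelfand p α| ≤ r}) :
    ∃ ν : Measure (CharSpace A), IsRepresentingRadon L K ν := by
  have := locallyCompactSpace_of_proper hp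
  obtain ⟨G, hGL, hG⟩ := exists_positive_extension L hpos
  let Λ : C_c(K, ℝ) →ₚ[ℝ] ℝ := PositiveLinearMap.mk₀ (G ∘ₗ LinearMap.inr ℝ A C_c(K, ℝ))
    fun g hg => hG 0 g fun x => by simpa using hg x
  have hΛ : ∀ g, Λ g = G (0, g) := fun g => rfl
  have hsub : ∀ a g, G (a, -g) = L a - Λ g := fun a g => by
    rw [← hGL, hΛ, ← map_sub]
    simp
  let μ := RealRMK.rieszMeasure Λ
  have hμ : ∀ g : C_c(K, ℝ), ∫ x, g x ∂μ = Λ g := RealRMK.integral_rieszMeasure Λ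
  have hmeas : ∀ a : A, Continuous fun x : K => gelfand a x.1 := fun a =>
    (continuous_gelfand a).comp continuous_subtype_val
  -- integrals of the functions that are nonnegative on `K`
  have hint_nonneg : ∀ a ∈ Pos K, Integrable (fun x : K => gelfand a x.1) μ := by
    intro a ha
    -- Since `â χ_n ≤ â` on `K`, positivity of `G` gives a bound that is uniform in `n`; Fatou's
    -- lemma then passes to `â`.
    have hbound : ∀ n, ∫⁻ x, ENNReal.ofReal (truncation hp n a x) ∂μ ≤ ENNReal.ofReal (L a) := by
      intro n
      rw [← ofReal_integral_eq_lintegral_ofReal, hμ]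
      · refine ENNReal.ofReal_le_ofReal ?_
        have := hG a (-truncation hp n a) fun x => by
          have h1 := cutoff_le_one p n x.1
          have h2 := ha x.1 x.2
          have : (-truncation hp n a) x = -(gelfand a x.1 * cutoff p n x.1) := rfl
          rw [this]
          nlinarith
        rw [hsub] at this
        linarith
      · exact (truncation hp n a).continuous.integrable_of_hasCompactSupport
          (truncation hp n a).hasCompactSupport
      · exact ae_of_all _ fun x => mul_nonneg (ha x.1 x.2) (cutoff_nonneg _ _ _)
    refine ⟨(hmeas a).aestronglyMeasurable, ?_⟩
    rw [hasFiniteIntegral_iff_ofReal (ae_of_all _ fun x : K => ha x.1 x.2)]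
    calc ∫⁻ x : K, ENNReal.ofReal (gelfand a x.1) ∂μ
        = ∫⁻ x, liminf (fun n => ENNReal.ofReal (truncation hp n a x)) atTop ∂μ := by
          refine lintegral_congr fun x => (Tendsto.liminf_eq ?_).symm
          refine ENNReal.tendsto_ofReal ?_
          simpa [truncation_apply] using (tendsto_cutoff p x.1).const_mul (gelfand a x.1)
      _ ≤ liminf (fun n => ∫⁻ x, ENNReal.ofReal (truncation hp n a x) ∂μ) atTop :=
          lintegral_liminf_le fun n =>
            ENNReal.measurable_ofReal.comp (truncation hp n a).continuous.measurable
      _ ≤ ENNReal.ofReal (L a) := liminf_le_of_le (by isBoundedDefault) fun b hb => by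
          obtain ⟨n, hn⟩ := hb.exists
          exact hn.trans (hbound n)
      _ < ⊤ := ENNReal.ofReal_lt_top
  have hint : ∀ a : A, Integrable (fun x : K => gelfand a x.1) μ := fun a =>
    (hint_nonneg (1 + a ^ 2) fun α _ => (abs_nonneg _).trans (abs_gelfand_le a α)).mono'
      (hmeas a).aestronglyMeasurable (ae_of_all _ fun x => abs_gelfand_le a x.1)
  have heq : ∀ a : A, L a = ∫ x : K, gelfand a x.1 ∂μ := by
    intro a
    have h1 : Tendsto (fun n => Λ (truncation hp n a)) atTop (𝓝 (∫ x : K, gelfand a x.1 ∂μ)) := by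
      simp_rw [← hμ]
      refine tendsto_integral_of_dominated_convergence (fun x => |gelfand a x.1|)
        (fun n => (truncation hp n a).continuous.aestronglyMeasurable) (hint a).abs
        (fun n => ae_of_all _ fun x => ?_) (ae_of_all _ fun x => ?_)
      · rw [truncation_apply, norm_mul, Real.norm_eq_abs, Real.norm_eq_abs,
          abs_of_nonneg (cutoff_nonneg _ _ _)]
        exact mul_le_of_le_one_right (abs_nonneg _) (cutoff_le_one _ _ _)
      · simpa [truncation_apply] using (tendsto_cutoff p x.1).const_mul (gelfand a x.1)
    -- Positivity of `G` turns the pointwise bound `n² (â - â χ_n) ≤ (1 + â²) p̂²` into this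
    -- one-sided estimate. Its use for both `a` and `-a` gives convergence of `Λ (â χ_n)` to `L a`.
    have h2 : ∀ a : A, ∀ n : ℕ, (n : ℝ) ^ 2 * (L a - Λ (truncation hp n a)) ≤
        L ((1 + a ^ 2) * p ^ 2) := by
      intro a n
      have := hG ((1 + a ^ 2) * p ^ 2 - (n : ℝ) ^ 2 • a) ((n : ℝ) ^ 2 • truncation hp n a)
        fun x => by
          have h1 := gelfand_sub_truncation_le p n a x.1
          have h2 : ((n : ℝ) ^ 2 • truncation hp n a) x =
            (n : ℝ) ^ 2 * (gelfand a x.1 * cutoff p n x.1) := rfl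
          have h3 := mul_le_mul_of_nonneg_left (mul_le_mul_of_nonneg_right
            (le_abs_self (gelfand a x.1)) (sub_nonneg.2 (cutoff_le_one p n x.1)))
            (sq_nonneg (n : ℝ))
          rw [h2, gelfand_sub, gelfand_smul]
          linarith
      have h4 := hsub ((1 + a ^ 2) * p ^ 2 - (n : ℝ) ^ 2 • a) (-((n : ℝ) ^ 2 • truncation hp n a))
      rw [neg_neg, map_sub, map_neg, map_smul, map_smul, smul_eq_mul, smul_eq_mul] at h4
      rw [h4] at this
      linarith
    have h3 : ∀ n : ℕ, Λ (truncation hp n (-a)) = -Λ (truncation hp n a) := fun n => by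
      rw [← map_neg]
      congr 1
      ext x
      simp [truncation_apply]
    refine tendsto_nhds_unique ?_ h1
    have h4 : Tendsto (fun n : ℕ => L ((1 + a ^ 2) * p ^ 2) * ((n : ℝ) ^ 2)⁻¹) atTop (𝓝 0) := by
      rw [← mul_zero (L ((1 + a ^ 2) * p ^ 2))]
      exact ((tendsto_pow_atTop two_ne_zero).comp
        tendsto_natCast_atTop_atTop).inv_tendsto_atTop.const_mul _
    rw [tendsto_iff_norm_sub_tendsto_zero]
    refine squeeze_zero' (.of_forall fun n => norm_nonneg _) ?_ h4
    filter_upwards [eventually_gt_atTop 0] with n hn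
    have hn' : (0 : ℝ) < (n : ℝ) ^ 2 := by positivity
    rw [← div_eq_mul_inv, le_div_iff₀ hn', Real.norm_eq_abs]
    have h5 := h2 a n
    have h6 := h2 (-a) n
    rw [h3, map_neg, neg_sq] at h6
    rcases abs_cases (Λ (truncation hp n a) - L a) with ⟨h, -⟩ | ⟨h, -⟩ <;> rw [h] <;> nlinarith
  have hfin : IsFiniteMeasure μ := by
    have := hint 1
    simp only [gelfand_one] at this
    simpa [integrable_const_iff, isFiniteMeasure_iff] using this
  have hval : Measurable (Subtype.val : K → CharSpace A) := measurable_subtype_coe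
  have hreg : (μ.map Subtype.val).InnerRegular := by
    have : μ.InnerRegular := inferInstance
    exact this.map_of_continuous continuous_subtype_val
  refine ⟨μ.map Subtype.val, ⟨hK.measurableSet, ?_, fun a => ?_, fun a => ?_⟩, ⟨inferInstance, hreg⟩⟩
  · rw [Measure.map_apply hval hK.measurableSet.compl]
    simp
  · exact (integrable_map_measure (continuous_gelfand a).aestronglyMeasurable
      hval.aemeasurable).2 (hint a)
  · rw [integral_map hval.aemeasurable (continuous_gelfand a).aestronglyMeasurable]
    exact heq a

theorem pos_closure_restrict {K : Set (CharSpace A)} {S : Subalgebra ℝ A} {a : S}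
    (ha : a ∈ Pos (closure (restrict S '' K))) : (a : A) ∈ Pos K :=
  fun α hα => ha (restrict S α) (subset_closure (mem_image_of_mem _ hα))

/-- A bound on the sum of the squares of the finitely many generators bounds each generator, so this
sum serves as the proper element in Haviland's theorem. -/
theorem exists_representing_finGen (L : A →ₗ[ℝ] ℝ) {K : Set (CharSpace A)}
    (hpos : ∀ a ∈ Pos K, 0 ≤ L a) (S : FinGen A) :
    ∃ μS : Measure (CharSpace S.1),
      IsRepresentingRadon (restrictFunctional L S.1) (closure (restrict S.1 '' K)) μS := by
  obtain ⟨G, hG⟩ := S.exists_generators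
  refine exists_representing_of_proper _ isClosed_closure
    (fun a ha => hpos _ (pos_closure_restrict ha)) (p := ∑ a ∈ G, a ^ 2) fun r => ?_
  refine isCompact_of_bounded_generators hG
    (isClosed_closure.inter (isClosed_le (continuous_gelfand _).abs continuous_const))
    fun a ha => ⟨r + 1, fun α hα => ?_⟩
  have h1 : gelfand a α ^ 2 ≤ r := by
    have h2 := (le_abs_self _).trans hα.2
    rw [gelfand_sum] at h2
    simp only [gelfand_pow] at h2
    exact (Finset.single_le_sum (f := fun a => gelfand a α ^ 2) (fun _ _ => sq_nonneg _) ha).trans h2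
  have h2 := abs_gelfand_le a α
  rw [gelfand_add, gelfand_one, gelfand_pow] at h2
  linarith

end Haviland

/-! ### Push-forwards to the spaces `X(S)` -/

section Projections

variable {A : Type*} [CommRing A] [Algebra ℝ A]

theorem IsRepresenting.isProbabilityMeasure {m : MeasurableSpace (CharSpace A)} {L : A →ₗ[ℝ] ℝ}
    (hL1 : L 1 = 1) {K : Set (CharSpace A)} {ν : Measure[m] (CharSpace A)}
    (h : IsRepresenting L K ν) : IsProbabilityMeasure ν := by
  have h1 := h.integrable 1
  have h2 := h.eq_integral 1
  simp only [gelfand_one] at h1 h2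
  rw [hL1, integral_const, smul_eq_mul, mul_one] at h2
  constructor
  have h3 : ν.real univ = 1 := h2.symm
  rwa [measureReal_def, ENNReal.toReal_eq_one_iff] at h3

theorem restrictFunctional_one (L : A →ₗ[ℝ] ℝ) (S : Subalgebra ℝ A) :
    restrictFunctional L S 1 = L 1 := rfl

variable {Ω : Type*} [MeasurableSpace Ω] {μ : Measure Ω} {φ : Ω → CharSpace A}

/-- Countable generation matters here: measurability of the coordinates alone gives Borel
measurability into `X(T)`. The source `Ω` is arbitrary so that `X(A)` may carry either the Borel or
the cylinder σ-algebra. -/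
theorem measurable_restrict_comp (hφ : ∀ a : A, Measurable fun ω => gelfand a (φ ω))
    (T : CountGen A) : Measurable fun ω => restrict T.1 (φ ω) := by
  obtain ⟨G, hGc, hG⟩ := T.exists_generators
  exact measurable_of_generators hGc hG fun a _ => hφ a

theorem isRepresentingRadon_map [IsFiniteMeasure μ]
    (hφ : ∀ a : A, Measurable fun ω => gelfand a (φ ω)) {L : A →ₗ[ℝ] ℝ}
    (hint : ∀ a : A, Integrable (fun ω => gelfand a (φ ω)) μ)
    (heq : ∀ a : A, L a = ∫ ω, gelfand a (φ ω) ∂μ) (T : CountGen A) {C : Set (CharSpace T.1)}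
    (hC : IsClosed C) (hμC : μ {ω | restrict T.1 (φ ω) ∈ C}ᶜ = 0) :
    IsRepresentingRadon (restrictFunctional L T.1) C (μ.map fun ω => restrict T.1 (φ ω)) := by
  have hm := measurable_restrict_comp hφ T
  obtain ⟨G, hGc, hG⟩ := T.exists_generators
  refine ⟨⟨hC.measurableSet, ?_, fun a => ?_, fun a => ?_⟩,
    ⟨inferInstance, innerRegular_of_generators hGc hG _⟩⟩
  · rwa [Measure.map_apply hm hC.measurableSet.compl]
  · exact (integrable_map_measure (continuous_gelfand a).aestronglyMeasurable
      hm.aemeasurable).2 (hint a)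
  · rw [integral_map hm.aemeasurable (continuous_gelfand a).aestronglyMeasurable]
    exact heq a

theorem map_restrictLE_map (hφ : ∀ a : A, Measurable fun ω => gelfand a (φ ω))
    {S T : Subalgebra ℝ A} (hT : ∃ G : Set A, G.Countable ∧ Algebra.adjoin ℝ G = T) (h : S ≤ T) :
    (μ.map fun ω => restrict T (φ ω)).map (restrictLE h) = μ.map fun ω => restrict S (φ ω) :=
  Measure.map_map (measurable_restrictLE h) (measurable_restrict_comp hφ ⟨T, hT⟩)

/-- A measure on a space mapped to `X(A)` induces representing measures on the character spaces
of finitely generated subalgebras which extend to a thick system. -/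
theorem exists_thick_system [IsProbabilityMeasure μ]
    (hφ : ∀ a : A, Measurable fun ω => gelfand a (φ ω)) {L : A →ₗ[ℝ] ℝ}
    (hint : ∀ a : A, Integrable (fun ω => gelfand a (φ ω)) μ)
    (heq : ∀ a : A, L a = ∫ ω, gelfand a (φ ω) ∂μ) {K : Set (CharSpace A)}
    (hK : ∀ S : FinGen A, μ {ω | restrict S.1 (φ ω) ∈ closure (restrict S.1 '' K)}ᶜ = 0) :
    ∃ μI : (S : FinGen A) → Measure (CharSpace S.1),
      (∀ S, IsRepresentingRadon (restrictFunctional L S.1) (closure (restrict S.1 '' K)) (μI S)) ∧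
      IsExact μI ∧ ∃ μΛ : (T : CountGen A) → Measure (CharSpace T.1),
        Corresponds μI μΛ ∧ IsExact μΛ ∧ IsThick μΛ := by
  refine ⟨fun S => μ.map fun ω => restrict S.1 (φ ω),
    fun S => isRepresentingRadon_map hφ hint heq S.toCountGen isClosed_closure (hK S),
    fun S T h => map_restrictLE_map hφ (FinGen.toCountGen T).2 h,
    fun T => μ.map fun ω => restrict T.1 (φ ω), ⟨fun T => ?_, fun T => ?_, fun S T h => ?_⟩,
    fun S T h => map_restrictLE_map hφ T.2 h, fun S M hM hdisj => ?_⟩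
  · exact (isRepresentingRadon_map hφ hint heq T isClosed_univ (by simp)).radon
  · exact Measure.isProbabilityMeasure_map (measurable_restrict_comp hφ T).aemeasurable
  · exact map_restrictLE_map hφ T.2 h
  · rw [Measure.map_apply (measurable_restrict_comp hφ S) hM]
    convert measure_empty (μ := μ)
    exact eq_empty_of_forall_notMem fun ω hω =>
      (eq_empty_iff_forall_notMem.1 hdisj) _ ⟨mem_range_self (φ ω), hω⟩

end Projections

/-! ### Measures on the cylinder σ-algebra -/

section Cylinder

variable {A : Type*} [CommRing A] [Algebra ℝ A]

theorem measurable_gelfand_sigmaCyl (a : A) : Measurable[sigmaCyl A] (gelfand a) := by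
  have h : Measurable[sigmaCyl A] (restrict (FinGen.adjoin {a}).1) :=
    Measurable.of_comap_le (le_iSup (fun S : FinGen A =>
      MeasurableSpace.comap (restrict S.1) (borel (CharSpace S.1))) (FinGen.adjoin {a}))
  exact (continuous_gelfand (⟨a, FinGen.mem_adjoin (Finset.mem_singleton_self a)⟩ :
    (FinGen.adjoin {a}).1)).measurable.comp h

theorem measurable_restrict_sigmaCyl (T : CountGen A) :
    Measurable[sigmaCyl A] (restrict T.1) :=
  @measurable_restrict_comp A _ _ (CharSpace A) (sigmaCyl A) id measurable_gelfand_sigmaCyl T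

theorem CountGen.exists_le (T : ℕ → CountGen A) : ∃ T' : CountGen A, ∀ n, (T n).1 ≤ T'.1 := by
  choose G hGc hG using fun n => (T n).2
  refine ⟨⟨Algebra.adjoin ℝ (⋃ n, G n), _, countable_iUnion hGc, rfl⟩, fun n => ?_⟩
  rw [← hG n]
  exact Algebra.adjoin_mono (subset_iUnion G n)

theorem CountGen.exists_le₂ (S T : CountGen A) : ∃ T' : CountGen A, S.1 ≤ T'.1 ∧ T.1 ≤ T'.1 := by
  obtain ⟨T', h⟩ := CountGen.exists_le fun n => if n = 0 then S else T
  exact ⟨T', h 0, h 1⟩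

/-- The sets of the cylinder σ-algebra depend on countably many elements of `A` only. -/
theorem exists_preimage_of_measurableSet_sigmaCyl {s : Set (CharSpace A)}
    (hs : MeasurableSet[sigmaCyl A] s) :
    ∃ (T : CountGen A) (M : Set (CharSpace T.1)), MeasurableSet M ∧ restrict T.1 ⁻¹' M = s := by
  -- The preimages already form a σ-algebra: for a countable union, all sets are moved to one
  -- countably generated subalgebra containing the given ones.
  let m : MeasurableSpace (CharSpace A) :=
    { MeasurableSet' := fun s => ∃ (T : CountGen A) (M : Set (CharSpace T.1)),
        MeasurableSet M ∧ restrict T.1 ⁻¹' M = s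
      measurableSet_empty := ⟨(FinGen.adjoin ∅).toCountGen, ∅, MeasurableSet.empty, rfl⟩
      measurableSet_compl := by
        rintro _ ⟨T, M, hM, rfl⟩
        exact ⟨T, Mᶜ, hM.compl, rfl⟩
      measurableSet_iUnion := by
        intro f hf
        choose T M hM hf using hf
        obtain ⟨T', hT'⟩ := CountGen.exists_le T
        refine ⟨T', ⋃ n, restrictLE (hT' n) ⁻¹' M n,
          MeasurableSet.iUnion fun n => measurable_restrictLE (hT' n) (hM n), ?_⟩
        rw [preimage_iUnion]
        exact iUnion_congr hf }
  have h : sigmaCyl A ≤ m := by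
    refine iSup_le fun S => ?_
    rintro _ ⟨M, hM, rfl⟩
    exact ⟨S.toCountGen, M, hM, rfl⟩
  exact h s hs

/-- The symmetric difference of `M` and `N` misses the image of `X(A)`, so it is null by thickness.
-/
theorem IsThick.measure_eq_of_preimage_eq {μΛ : (T : CountGen A) → Measure (CharSpace T.1)}
    (hthick : IsThick μΛ) (T : CountGen A) {M N : Set (CharSpace T.1)} (hM : MeasurableSet M)
    (hN : MeasurableSet N) (h : restrict T.1 ⁻¹' M = restrict T.1 ⁻¹' N) : μΛ T M = μΛ T N := by
  refine measure_congr (measure_symmDiff_eq_zero_iff.1 (hthick T _ (hM.symmDiff hN) ?_))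
  refine eq_empty_of_forall_notMem ?_
  rintro _ ⟨⟨α, rfl⟩, hα⟩
  have h1 : α ∈ restrict T.1 ⁻¹' M ↔ α ∈ restrict T.1 ⁻¹' N := by rw [h]
  rcases hα with hα | hα
  · exact hα.2 (h1.1 hα.1)
  · exact hα.2 (h1.2 hα.1)

theorem measure_preimage_restrictLE {μΛ : (T : CountGen A) → Measure (CharSpace T.1)}
    (hexact : IsExact μΛ) {S T : CountGen A} (h : S.1 ≤ T.1) {M : Set (CharSpace S.1)}
    (hM : MeasurableSet M) : μΛ T (restrictLE h ⁻¹' M) = μΛ S M := by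
  rw [← hexact S T h, Measure.map_apply (measurable_restrictLE h) hM]

theorem IsThick.measure_eq_of_preimage_eq' {μΛ : (T : CountGen A) → Measure (CharSpace T.1)}
    (hexact : IsExact μΛ) (hthick : IsThick μΛ) {S T : CountGen A} {M : Set (CharSpace S.1)}
    {N : Set (CharSpace T.1)} (hM : MeasurableSet M) (hN : MeasurableSet N)
    (h : restrict S.1 ⁻¹' M = restrict T.1 ⁻¹' N) : μΛ S M = μΛ T N := by
  obtain ⟨T', h1, h2⟩ := CountGen.exists_le₂ S T
  rw [← measure_preimage_restrictLE hexact h1 hM, ← measure_preimage_restrictLE hexact h2 hN]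
  exact hthick.measure_eq_of_preimage_eq T' (measurable_restrictLE h1 hM)
    (measurable_restrictLE h2 hN) h

/-- A thick exact system on the countably generated subalgebras comes from a measure on the
cylinder σ-algebra. -/
theorem exists_measure_of_isThick {μΛ : (T : CountGen A) → Measure (CharSpace T.1)}
    (hexact : IsExact μΛ) (hthick : IsThick μΛ) :
    ∃ μ : Measure[sigmaCyl A] (CharSpace A), ∀ (T : CountGen A) (M : Set (CharSpace T.1)),
      MeasurableSet M → μ (restrict T.1 ⁻¹' M) = μΛ T M := by
  choose T M hM hTM using fun (s : Set (CharSpace A)) (hs : MeasurableSet[sigmaCyl A] s) =>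
    exists_preimage_of_measurableSet_sigmaCyl hs
  refine ⟨@Measure.ofMeasurable _ (sigmaCyl A) (fun s hs => μΛ (T s hs) (M s hs)) ?_ ?_,
    fun S N hN => ?_⟩
  · rw [hthick.measure_eq_of_preimage_eq (T _ _) (hM _ _) MeasurableSet.empty (hTM _ _),
      measure_empty]
  · intro f hf hdisj
    obtain ⟨T', hT'⟩ := CountGen.exists_le fun n => T (f n) (hf n)
    have hN : ∀ n, MeasurableSet (restrictLE (hT' n) ⁻¹' M (f n) (hf n)) := fun n =>
      measurable_restrictLE (hT' n) (hM _ _)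
    have hpre : ∀ n, restrict T'.1 ⁻¹' (restrictLE (hT' n) ⁻¹' M (f n) (hf n)) = f n :=
      fun n => hTM (f n) (hf n)
    have h1 : μΛ (T (⋃ n, f n) (.iUnion hf)) (M (⋃ n, f n) (.iUnion hf)) =
        μΛ T' (⋃ n, restrictLE (hT' n) ⁻¹' M (f n) (hf n)) := by
      refine hthick.measure_eq_of_preimage_eq' hexact (hM _ _) (.iUnion hN) ?_
      rw [hTM, preimage_iUnion]
      exact (iUnion_congr hpre).symm
    -- Disjoint sets in `X(A)` may come from overlapping sets in `X(T')`. The overlaps miss the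
    -- image of `X(A)`, so thickness gives disjointness up to null sets.
    rw [h1, measure_iUnion₀ ?_ fun n => (hN n).nullMeasurableSet]
    · exact tsum_congr fun n => measure_preimage_restrictLE hexact (hT' n) (hM _ _)
    · intro i j hij
      refine hthick T' _ ((hN i).inter (hN j)) (eq_empty_of_forall_notMem ?_)
      rintro _ ⟨⟨α, rfl⟩, hα⟩
      exact disjoint_left.1 (hdisj hij) ((hpre i).subset hα.1) ((hpre j).subset hα.2)
  · rw [@Measure.ofMeasurable_apply _ (sigmaCyl A) _ _ _ _ (measurable_restrict_sigmaCyl S hN)]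
    exact hthick.measure_eq_of_preimage_eq' hexact (hM _ _) hN (hTM _ _)

/-- Integrability and the value of the integral of `â` can be read off from the single subalgebra
generated by `a`. -/
theorem isRepresenting_of_measure_preimage_restrict {m : MeasurableSpace (CharSpace A)}
    {L : A →ₗ[ℝ] ℝ} {μ : Measure[m] (CharSpace A)} (C : (S : FinGen A) → Set (CharSpace S.1))
    {μI : (S : FinGen A) → Measure (CharSpace S.1)}
    (hrep : ∀ S, IsRepresentingRadon (restrictFunctional L S.1) (C S) (μI S))
    (hm : ∀ S : FinGen A, Measurable[m] (restrict S.1))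
    (hμ : ∀ (S : FinGen A) (M : Set (CharSpace S.1)), MeasurableSet M →
      μ (restrict S.1 ⁻¹' M) = μI S M) :
    IsRepresenting L univ μ ∧ ∀ S : FinGen A, μ (restrict S.1 ⁻¹' C S)ᶜ = 0 := by
  have hmap : ∀ S : FinGen A, μ.map (restrict S.1) = μI S := fun S => by
    ext M hM
    rw [Measure.map_apply (hm S) hM, hμ S M hM]
  have key : ∀ a : A, Integrable (gelfand a) μ ∧ L a = ∫ α, gelfand a α ∂μ := by
    intro a
    let S := FinGen.adjoin {a}
    let b : S.1 := ⟨a, FinGen.mem_adjoin (Finset.mem_singleton_self a)⟩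
    have h1 := (hrep S).representing.integrable b
    have h2 := (hrep S).representing.eq_integral b
    rw [← hmap, integrable_map_measure (continuous_gelfand b).aestronglyMeasurable
      (hm S).aemeasurable] at h1
    rw [← hmap, integral_map (hm S).aemeasurable
      (continuous_gelfand b).aestronglyMeasurable] at h2
    exact ⟨h1, h2⟩
  refine ⟨⟨MeasurableSet.univ, by simp, fun a => (key a).1, fun a => (key a).2⟩, fun S => ?_⟩
  have h := (hrep S).representing
  rw [← preimage_compl, hμ S _ h.measurableSet.compl]
  exact h.supported

theorem exists_representing_of_isThick {L : A →ₗ[ℝ] ℝ} {K : Set (CharSpace A)}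
    {μI : (S : FinGen A) → Measure (CharSpace S.1)}
    (hrep : ∀ S, IsRepresentingRadon (restrictFunctional L S.1)
      (closure (restrict S.1 '' K)) (μI S))
    {μΛ : (T : CountGen A) → Measure (CharSpace T.1)} (hcorr : Corresponds μI μΛ)
    (hexact : IsExact μΛ) (hthick : IsThick μΛ) :
    ∃ μ : Measure[sigmaCyl A] (CharSpace A), IsRepresenting L univ μ ∧
      ∀ S : FinGen A, μ (restrict S.1 ⁻¹' closure (restrict S.1 '' K))ᶜ = 0 := by
  obtain ⟨μ, hμ⟩ := exists_measure_of_isThick hexact hthick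
  refine ⟨μ, isRepresenting_of_measure_preimage_restrict _ hrep
    (fun S => measurable_restrict_sigmaCyl S.toCountGen) fun S M hM => ?_⟩
  have h : S.1 ≤ S.toCountGen.1 := le_refl S.1
  rw [← hcorr.map_eq S S.toCountGen h, Measure.map_apply (measurable_restrictLE _) hM]
  exact hμ S.toCountGen M hM

theorem isQuadraticModule_pos (K : Set (CharSpace A)) : IsQuadraticModule (Pos K) where
  one_mem α _ := by simp
  add_mem a ha b hb α hα := by
    rw [gelfand_add]
    exact add_nonneg (ha α hα) (hb α hα)
  sq_mul_mem _ _ hb α hα := by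
    rw [gelfand_mul, gelfand_pow]
    exact mul_nonneg (sq_nonneg _) (hb α hα)

/-- The elements that are nonnegative on `nonnegSet G` form a quadratic module containing `G`, hence
they contain `Q`. -/
theorem nonnegSet_eq_of_isGeneratedBy {Q G : Set A} (h : IsGeneratedBy Q G) :
    nonnegSet Q = nonnegSet G :=
  Subset.antisymm (fun _ hα a ha => hα a (h.1.2 ha)) fun α hα _ ha =>
    h.2 ⟨isQuadraticModule_pos (nonnegSet G), fun _ hb _ hβ => hβ _ hb⟩ ha α hα

theorem isRepresenting_nonnegSet {L : A →ₗ[ℝ] ℝ} {G : Set A} (hG : G.Countable)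
    {μ : Measure[sigmaCyl A] (CharSpace A)} (hμ : IsRepresenting L univ μ)
    (hsupp : ∀ S : FinGen A,
      μ (restrict S.1 ⁻¹' closure (restrict S.1 '' nonnegSet G))ᶜ = 0) :
    IsRepresenting L (nonnegSet G) μ := by
  have hset : nonnegSet G = ⋂ a ∈ G, gelfand a ⁻¹' Ici 0 := by
    ext α
    simp [nonnegSet]
  refine ⟨?_, ?_, hμ.integrable, hμ.eq_integral⟩
  · rw [hset]
    exact MeasurableSet.biInter hG fun a _ => measurable_gelfand_sigmaCyl a measurableSet_Ici
  · rw [hset, compl_iInter₂, measure_biUnion_null_iff hG]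
    intro a ha
    -- The half-space `â ≥ 0` is closed already in the character space of the subalgebra generated
    -- by `a`, so it contains the closure of the projection there, which carries the mass.
    refine measure_mono_null (compl_subset_compl.2 fun α hα => ?_) (hsupp (FinGen.adjoin {a}))
    let b : (FinGen.adjoin {a}).1 := ⟨a, FinGen.mem_adjoin (Finset.mem_singleton_self a)⟩
    have hcl : closure (restrict (FinGen.adjoin {a}).1 '' nonnegSet G) ⊆ gelfand b ⁻¹' Ici 0 := by
      refine closure_minimal ?_ (isClosed_Ici.preimage (continuous_gelfand b))
      rintro _ ⟨β, hβ, rfl⟩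
      exact hβ a ha
    exact hcl hα

end Cylinder

/-! ### Prokhorov's condition and Radon measures -/

section Prokhorov

variable {A : Type*} [CommRing A] [Algebra ℝ A]

theorem FinGen.eventually_mem (a : A) : ∀ᶠ S : FinGen A in atTop, a ∈ S.1 := by
  filter_upwards [eventually_ge_atTop (FinGen.adjoin {a})] with S hS
  exact hS (FinGen.mem_adjoin (Finset.mem_singleton_self a))

open Classical in
/-- The integral of `â` over the part `E S` of `X(S)`, if `a ∈ S`. -/
noncomputable def localIntegral (μ : (S : FinGen A) → Measure (CharSpace S.1))
    (E : (S : FinGen A) → Set (CharSpace S.1)) (a : A) (S : FinGen A) : ℝ :=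
  if h : a ∈ S.1 then ∫ β in E S, gelfand (⟨a, h⟩ : S.1) β ∂μ S else 0

theorem localIntegral_of_mem (μ : (S : FinGen A) → Measure (CharSpace S.1))
    (E : (S : FinGen A) → Set (CharSpace S.1)) {a : A} {S : FinGen A} (h : a ∈ S.1) :
    localIntegral μ E a S = ∫ β in E S, gelfand (⟨a, h⟩ : S.1) β ∂μ S := dif_pos h

variable {L : A →ₗ[ℝ] ℝ} {F : (S : FinGen A) → Set (CharSpace S.1)}
  {μ : (S : FinGen A) → Measure (CharSpace S.1)}

/-- The point is that the bound does not depend on `S` or `E`, so the local integrals of a fixed `a`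
eventually stay in one compact interval. -/
theorem abs_localIntegral_le
    (hrep : ∀ S, IsRepresentingRadon (restrictFunctional L S.1) (F S) (μ S))
    (E : (S : FinGen A) → Set (CharSpace S.1)) (a : A) {S : FinGen A} (h : a ∈ S.1) :
    |localIntegral μ E a S| ≤ L (1 + a ^ 2) := by
  have hint := (hrep S).representing.integrable
  let b : S.1 := ⟨a, h⟩
  rw [localIntegral_of_mem μ E h]
  calc |∫ β in E S, gelfand b β ∂μ S|
      ≤ ∫ β in E S, |gelfand b β| ∂μ S := abs_integral_le_integral_abs
    _ ≤ ∫ β, |gelfand b β| ∂μ S :=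
        setIntegral_le_integral (hint b).abs (ae_of_all _ fun β => abs_nonneg _)
    _ ≤ ∫ β, gelfand (1 + b ^ 2) β ∂μ S :=
        integral_mono (hint b).abs (hint _) (abs_gelfand_le b)
    _ = L (1 + a ^ 2) := ((hrep S).representing.eq_integral (1 + b ^ 2)).symm

/-- One ultrafilter makes all bounded nets of local integrals converge at once. Linearity passes to
the limit because eventually `S` contains the finitely many elements involved. -/
theorem exists_limitFunctional
    (hrep : ∀ S, IsRepresentingRadon (restrictFunctional L S.1) (F S) (μ S))
    {U : Ultrafilter (FinGen A)} (hU : (U : Filter (FinGen A)) ≤ atTop)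
    (E : (S : FinGen A) → Set (CharSpace S.1)) :
    ∃ Φ : A →ₗ[ℝ] ℝ, ∀ a, Tendsto (localIntegral μ E a) U (𝓝 (Φ a)) := by
  have hlim : ∀ a, ∃ x, Tendsto (localIntegral μ E a) U (𝓝 x) := by
    intro a
    have hmem : Icc (-L (1 + a ^ 2)) (L (1 + a ^ 2)) ∈ U.map (localIntegral μ E a) :=
      hU ((FinGen.eventually_mem a).mono fun S h => abs_le.1 (abs_localIntegral_le hrep E a h))
    obtain ⟨x, -, hx⟩ := isCompact_Icc.ultrafilter_le_nhds' _ hmem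
    exact ⟨x, hx⟩
  choose Φ hΦ using hlim
  refine ⟨⟨⟨Φ, fun a b => ?_⟩, fun r a => ?_⟩, hΦ⟩
  · refine tendsto_nhds_unique (hΦ (a + b)) (((hΦ a).add (hΦ b)).congr' ?_)
    filter_upwards [hU (FinGen.eventually_mem a), hU (FinGen.eventually_mem b)] with S ha hb
    have hint := (hrep S).representing.integrable
    rw [localIntegral_of_mem μ E ha, localIntegral_of_mem μ E hb,
      localIntegral_of_mem μ E (add_mem ha hb),
      ← integral_add (hint _).integrableOn (hint _).integrableOn]
    exact integral_congr_ae (ae_of_all _ fun β =>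
      (gelfand_add (⟨a, ha⟩ : S.1) ⟨b, hb⟩ β).symm)
  · refine tendsto_nhds_unique (hΦ (r • a)) (((hΦ a).const_mul r).congr' ?_)
    filter_upwards [hU (FinGen.eventually_mem a)] with S ha
    rw [localIntegral_of_mem μ E ha, localIntegral_of_mem μ E (S.1.smul_mem ha r),
      ← integral_const_mul]
    exact integral_congr_ae (ae_of_all _ fun β => (gelfand_smul r (⟨a, ha⟩ : S.1) β).symm)

/-- For `D` compact and `a` positive on `D ∩ K`, `â` is almost nonnegative on
`π_S(D) ∩ closure (π_S(K))` for large `S`. -/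
theorem eventually_neg_lt_gelfand {K D : Set (CharSpace A)} (hK : IsClosed K) (hD : IsCompact D)
    {a : A} (ha : a ∈ Pos (D ∩ K)) {ε : ℝ} (hε : 0 < ε) :
    ∀ᶠ S : FinGen A in atTop, ∀ α ∈ D, restrict S.1 α ∈ closure (restrict S.1 '' K) →
      -ε < gelfand a α := by
  have hmono : ∀ {S T : FinGen A}, S ≤ T → restrict T.1 ⁻¹' closure (restrict T.1 '' K) ⊆
      restrict S.1 ⁻¹' closure (restrict S.1 '' K) := by
    intro S T h α hα
    have h1 := image_closure_subset_closure_image (continuous_restrictLE h)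
      (mem_image_of_mem (restrictLE h) hα)
    rwa [image_image] at h1
  -- The sets `π_S⁻¹(closure (π_S(K)))` decrease in `S` and their intersection lies in `K`, so it
  -- avoids the compact set of `α ∈ D` with `â ≤ -ε`. By compactness a single `S₀` already does.
  obtain ⟨S₀, hS₀⟩ := (hD.inter_right
    (isClosed_Iic.preimage (continuous_gelfand a) : IsClosed (gelfand a ⁻¹' Iic (-ε)))
    ).elim_directed_family_closed
    (fun S : FinGen A => restrict S.1 ⁻¹' closure (restrict S.1 '' K))
    (fun S => isClosed_closure.preimage (continuous_restrict S.1))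
    (eq_empty_of_forall_notMem fun α hα => by
      have h1 := ha α ⟨hα.1.1, mem_of_forall_restrict_mem_closure hK (mem_iInter.1 hα.2)⟩
      have h2 : gelfand a α ≤ -ε := hα.1.2
      linarith)
    (directed_of_isDirected_le fun S T h => hmono h)
  filter_upwards [eventually_ge_atTop S₀] with S hS α hα hαK
  by_contra h
  exact (eq_empty_iff_forall_notMem.1 hS₀) α ⟨⟨hα, not_lt.1 h⟩, hmono hS hαK⟩

/-- Almost every point of `E S` lifts to a point of `D` whose projection lies in the closure of
`π_S(K)`, where eventually `â > -ε`. As `μ S` has mass one, the local integral is then at least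
`-ε`. -/
theorem limitFunctional_nonneg (hL1 : L 1 = 1) {K D : Set (CharSpace A)} (hK : IsClosed K)
    (hrep : ∀ S, IsRepresentingRadon (restrictFunctional L S.1)
      (closure (restrict S.1 '' K)) (μ S))
    {U : Ultrafilter (FinGen A)} (hU : (U : Filter (FinGen A)) ≤ atTop)
    {E : (S : FinGen A) → Set (CharSpace S.1)} (hE : ∀ S, MeasurableSet (E S))
    (hD : IsCompact D) (hED : ∀ S, E S ⊆ restrict S.1 '' D) {a : A} (ha : a ∈ Pos (D ∩ K)) {x : ℝ}
    (hx : Tendsto (localIntegral μ E a) U (𝓝 x)) : 0 ≤ x := by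
  refine le_of_forall_pos_le_add fun ε hε => ?_
  suffices h : -ε ≤ x by linarith
  refine ge_of_tendsto hx ?_
  filter_upwards [hU (FinGen.eventually_mem a), hU (eventually_neg_lt_gelfand hK hD ha hε)]
    with S hS h
  have := (hrep S).representing.isProbabilityMeasure
    ((restrictFunctional_one L S.1).trans hL1)
  rw [localIntegral_of_mem μ E hS]
  have hK0 : ∀ᵐ β ∂μ S, β ∈ closure (restrict S.1 '' K) := (hrep S).representing.supported
  calc -ε ≤ -ε * (μ S).real (E S) := by
        have := measureReal_le_one (μ := μ S) (s := E S)
        nlinarith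
    _ = ∫ β in E S, -ε ∂μ S := by rw [setIntegral_const, smul_eq_mul, mul_comm]
    _ ≤ _ := by
        refine setIntegral_mono_on_ae (integrable_const _).integrableOn
          ((hrep S).representing.integrable _).integrableOn (hE S) ?_
        filter_upwards [hK0] with β hβ hβE
        obtain ⟨α, hα, rfl⟩ := hED S hβE
        exact (h α hα hβ).le

/-- Off `E S` the integrand is at most `δ â² + δ⁻¹`, and the mass there is at most `δ²`. The square
is what makes the second term contribute only `δ`. -/
theorem abs_sub_localIntegral_le (hL1 : L 1 = 1)
    (hrep : ∀ S, IsRepresentingRadon (restrictFunctional L S.1) (F S) (μ S))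
    {E : (S : FinGen A) → Set (CharSpace S.1)} {S : FinGen A} (hE : MeasurableSet (E S))
    {δ : ℝ} (hδ : 0 < δ) (hμE : ENNReal.ofReal (1 - δ ^ 2) ≤ μ S (E S)) {a : A} (h : a ∈ S.1) :
    |L a - localIntegral μ E a S| ≤ δ * (L (a ^ 2) + 1) := by
  have := (hrep S).representing.isProbabilityMeasure
    ((restrictFunctional_one L S.1).trans hL1)
  have hint := (hrep S).representing.integrable
  let b : S.1 := ⟨a, h⟩
  have h1 : L a - localIntegral μ E a S = ∫ β in (E S)ᶜ, gelfand b β ∂μ S := by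
    rw [localIntegral_of_mem μ E h, sub_eq_iff_eq_add', integral_add_compl hE (hint _)]
    exact (hrep S).representing.eq_integral b
  have h2 : (μ S).real (E S)ᶜ ≤ δ ^ 2 := by
    have h3 := (ENNReal.ofReal_le_iff_le_toReal (measure_ne_top _ _)).1 hμE
    rw [← measureReal_def] at h3
    rw [probReal_compl_eq_one_sub hE]
    linarith
  have h4 : ∀ β, |gelfand b β| ≤ δ * gelfand (b ^ 2) β + δ⁻¹ := by
    intro β
    have h5 : |gelfand b β| = δ⁻¹ * (δ * |gelfand b β|) := by field_simp
    have h6 : δ * gelfand (b ^ 2) β + δ⁻¹ = δ⁻¹ * ((δ * |gelfand b β|) ^ 2 + 1) := by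
      rw [gelfand_pow, mul_pow, sq_abs]
      field_simp
    rw [h5, h6]
    refine mul_le_mul_of_nonneg_left ?_ (inv_nonneg.2 hδ.le)
    nlinarith [sq_nonneg (δ * |gelfand b β| - 1), sq_nonneg (δ * |gelfand b β|)]
  rw [h1]
  calc |∫ β in (E S)ᶜ, gelfand b β ∂μ S|
      ≤ ∫ β in (E S)ᶜ, |gelfand b β| ∂μ S := abs_integral_le_integral_abs
    _ ≤ ∫ β in (E S)ᶜ, (δ * gelfand (b ^ 2) β + δ⁻¹) ∂μ S :=
        integral_mono (hint b).abs.integrableOn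
          (((hint _).const_mul δ).add (integrable_const _)).integrableOn h4
    _ = δ * ∫ β in (E S)ᶜ, gelfand (b ^ 2) β ∂μ S + (μ S).real (E S)ᶜ * δ⁻¹ := by
        rw [integral_add ((hint _).const_mul δ).integrableOn (integrable_const _),
          integral_const_mul, setIntegral_const, smul_eq_mul]
    _ ≤ δ * L (a ^ 2) + δ ^ 2 * δ⁻¹ := by
        refine add_le_add (mul_le_mul_of_nonneg_left ?_ hδ.le)
          (mul_le_mul_of_nonneg_right h2 (inv_nonneg.2 hδ.le))
        refine (setIntegral_le_integral (hint _) (ae_of_all _ fun β => ?_)).trans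
          ((hrep S).representing.eq_integral (b ^ 2)).ge
        rw [gelfand_pow]
        exact sq_nonneg _
    _ = δ * (L (a ^ 2) + 1) := by field_simp

theorem localIntegral_diff
    (hrep : ∀ S, IsRepresentingRadon (restrictFunctional L S.1) (F S) (μ S))
    {D E : (S : FinGen A) → Set (CharSpace S.1)} (hD : ∀ S, MeasurableSet (D S))
    (hDE : ∀ S, D S ⊆ E S) (a : A) (S : FinGen A) :
    localIntegral μ (fun S => E S \ D S) a S = localIntegral μ E a S - localIntegral μ D a S := by
  by_cases h : a ∈ S.1
  · rw [localIntegral_of_mem μ _ h, localIntegral_of_mem μ _ h, localIntegral_of_mem μ _ h]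
    exact setIntegral_sdiff (hD S) ((hrep S).representing.integrable _).integrableOn (hDE S)
  · simp [localIntegral, h]

/-- A countable sum of representing Radon measures for functionals `Φ n` with sum `L` represents
`L`. -/
theorem isRepresentingRadon_sum {Φ : ℕ → A →ₗ[ℝ] ℝ} {K : Set (CharSpace A)} (hK : IsClosed K)
    {D : ℕ → Set (CharSpace A)} (hDK : ∀ n, D n ⊆ K)
    {ν : ℕ → Measure (CharSpace A)} (hν : ∀ n, IsRepresentingRadon (Φ n) (D n) (ν n))
    (hL : ∀ a, Tendsto (fun N => ∑ n ∈ Finset.range N, Φ n a) atTop (𝓝 (L a))) :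
    IsRepresentingRadon L K (Measure.sum ν) := by
  -- Convergence of partial sums gives summability only for nonnegative terms, so integrability is
  -- proved first for `b̂ ≥ 0`; the general case follows from `|â| ≤ 1 + â²`.
  have hint_nonneg : ∀ b : A, (∀ α, 0 ≤ gelfand b α) → Integrable (gelfand b) (Measure.sum ν) := by
    intro b hb
    have hΦ : ∀ n, 0 ≤ Φ n b := fun n => by
      rw [(hν n).representing.eq_integral]
      exact integral_nonneg hb
    have hsum := (hasSum_iff_tendsto_nat_of_nonneg hΦ _).2 (hL b)
    refine ⟨(continuous_gelfand b).aestronglyMeasurable, ?_⟩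
    rw [hasFiniteIntegral_iff_ofReal (ae_of_all _ hb), lintegral_sum_measure]
    calc ∑' n, ∫⁻ α, ENNReal.ofReal (gelfand b α) ∂ν n = ∑' n, ENNReal.ofReal (Φ n b) :=
          tsum_congr fun n => by
            rw [(hν n).representing.eq_integral, ofReal_integral_eq_lintegral_ofReal
              ((hν n).representing.integrable b) (ae_of_all _ hb)]
      _ = ENNReal.ofReal (∑' n, Φ n b) := (ENNReal.ofReal_tsum_of_nonneg hΦ hsum.summable).symm
      _ < ⊤ := ENNReal.ofReal_lt_top
  have hint : ∀ a : A, Integrable (gelfand a) (Measure.sum ν) := fun a =>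
    (hint_nonneg (1 + a ^ 2) fun α => (abs_nonneg _).trans (abs_gelfand_le a α)).mono'
      (continuous_gelfand a).aestronglyMeasurable (ae_of_all _ (abs_gelfand_le a))
  have hfin : IsFiniteMeasure (Measure.sum ν) := by
    have := hint 1
    simp only [funext gelfand_one] at this
    simpa [integrable_const_iff, isFiniteMeasure_iff] using this
  have : ∀ n, (ν n).InnerRegular := fun n => (hν n).radon.innerRegular
  refine ⟨⟨hK.measurableSet, ?_, hint, fun a => ?_⟩, ⟨inferInstance, inferInstance⟩⟩
  · rw [Measure.sum_apply _ hK.measurableSet.compl, ENNReal.tsum_eq_zero]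
    exact fun n => measure_mono_null (compl_subset_compl.2 (hDK n)) (hν n).representing.supported
  · have h := (hasSum_integral_measure (hint a)).tendsto_sum_nat
    simp_rw [← (hν _).representing.eq_integral] at h
    exact tendsto_nhds_unique (hL a) h

theorem exists_representing_of_prokhorov (hL1 : L 1 = 1) {K : Set (CharSpace A)} (hK : IsClosed K)
    (hrep : ∀ S, IsRepresentingRadon (restrictFunctional L S.1)
      (closure (restrict S.1 '' K)) (μ S))
    (hprok : Prokhorov μ) : ∃ ν : Measure (CharSpace A), IsRepresentingRadon L K ν := by
  -- The tolerance is `δ²` with `δ = 1 / (n + 1)`, as `abs_sub_localIntegral_le` requires.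
  choose C hC hCμ using fun n : ℕ => hprok ((1 / ((n : ℝ) + 1)) ^ 2) (by positivity)
  -- `D N` uses only the indices below `N`: thus `D 0` is empty, which makes the shells telescope,
  -- and the shell `D (N + 1) \ D N` lies in the projection of the single compact set `C N`.
  let D : ℕ → (S : FinGen A) → Set (CharSpace S.1) := fun N S =>
    ⋃ n ∈ Finset.range N, restrict S.1 '' C n
  have hDm : ∀ N S, MeasurableSet (D N S) := fun N S => Finset.measurableSet_biUnion _ fun n _ =>
    ((hC n).image (continuous_restrict S.1)).isClosed.measurableSet
  have hDmono : ∀ N S, D N S ⊆ D (N + 1) S := fun N S =>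
    biUnion_subset_biUnion_left (Finset.range_mono N.le_succ)
  have hDsucc : ∀ N S, D (N + 1) S \ D N S ⊆ restrict S.1 '' C N := by
    rintro N S β ⟨h1, h2⟩
    simp only [D, Finset.range_add_one, Finset.set_biUnion_insert] at h1 h2
    exact h1.resolve_right h2
  let U : Ultrafilter (FinGen A) := Ultrafilter.of atTop
  have hU : (U : Filter (FinGen A)) ≤ atTop := Ultrafilter.of_le _
  choose Φ hΦ using fun n => exists_limitFunctional hrep hU fun S => D (n + 1) S \ D n S
  have hcomp : ∀ n, IsCompact (C n ∩ K) := fun n => (hC n).inter_right hK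
  -- On the compact set `C n ∩ K` even `p = 0` is proper.
  choose ν hν using fun n => exists_representing_of_proper (Φ n) (hcomp n).isClosed
    (fun a ha => limitFunctional_nonneg hL1 hK hrep hU (fun S => (hDm _ S).diff (hDm _ S))
      (hC n) (hDsucc n) ha (hΦ n a)) (p := 0)
    fun r => (hcomp n).inter_right (isClosed_le (continuous_gelfand 0).abs continuous_const)
  refine ⟨_, isRepresentingRadon_sum hK (fun n => inter_subset_right) hν fun a => ?_⟩
  have hpartial : ∀ N, Tendsto (localIntegral μ (D N) a) U
      (𝓝 (∑ n ∈ Finset.range N, Φ n a)) := by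
    intro N
    refine (tendsto_finsetSum _ fun n _ => hΦ n a).congr fun S => ?_
    simp_rw [localIntegral_diff hrep (hDm _) (hDmono _), Finset.sum_range_sub
      (fun n => localIntegral μ (D n) a S)]
    have : localIntegral μ (D 0) a S = 0 := by simp [localIntegral, D]
    rw [this, sub_zero]
  have hbound : ∀ n : ℕ, |L a - ∑ k ∈ Finset.range (n + 1), Φ k a| ≤
      1 / ((n : ℝ) + 1) * (L (a ^ 2) + 1) := by
    intro n
    refine le_of_tendsto ((tendsto_const_nhds.sub (hpartial (n + 1))).abs) ?_
    filter_upwards [hU (FinGen.eventually_mem a)] with S hS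
    refine abs_sub_localIntegral_le hL1 hrep (hDm _ S) (by positivity)
      ((hCμ n S).trans (measure_mono ?_)) hS
    exact subset_biUnion_of_mem (u := fun n => restrict S.1 '' C n)
      (Finset.self_mem_range_succ n)
  rw [← tendsto_add_atTop_iff_nat 1, tendsto_iff_norm_sub_tendsto_zero]
  refine squeeze_zero (fun n => norm_nonneg _) (fun n => ?_)
    (by simpa using tendsto_one_div_add_atTop_nhds_zero_nat.mul_const (L (a ^ 2) + 1))
  rw [norm_sub_rev, Real.norm_eq_abs, ← one_div]
  exact hbound n

/-- Inner regularity of `ν` on the whole space yields a compact `C` with mass above `1 - ε`, and `C`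
lies in the preimage of each of its projections. -/
theorem exists_prokhorov_system (hL1 : L 1 = 1) {K : Set (CharSpace A)}
    {ν : Measure (CharSpace A)} (hν : IsRepresentingRadon L K ν) :
    ∃ μI : (S : FinGen A) → Measure (CharSpace S.1),
      (∀ S, IsRepresentingRadon (restrictFunctional L S.1) (closure (restrict S.1 '' K)) (μI S)) ∧
      Prokhorov μI := by
  have := hν.representing.isProbabilityMeasure hL1
  have := hν.radon.innerRegular
  refine ⟨fun S => ν.map (restrict S.1), fun S => isRepresentingRadon_map (φ := id)
    (fun a => (continuous_gelfand a).measurable) hν.representing.integrable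
    hν.representing.eq_integral S.toCountGen isClosed_closure
    (measure_mono_null (compl_subset_compl.2 fun α hα => subset_closure (mem_image_of_mem _ hα))
      hν.representing.supported), fun ε hε => ?_⟩
  obtain ⟨C, -, hC, hCν⟩ := MeasurableSet.univ.exists_lt_isCompact (μ := ν)
    (r := ENNReal.ofReal (1 - ε)) (by
      rw [measure_univ, ENNReal.ofReal_lt_one]
      linarith)
  refine ⟨C, hC, fun S => hCν.le.trans ?_⟩
  rw [Measure.map_apply (continuous_restrict S.1).measurable
    (hC.image (continuous_restrict S.1)).isClosed.measurableSet]
  exact measure_mono (subset_preimage_image _ _)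

end Prokhorov

end Moment

theorem mainTheorem3 {A : Type*} [CommRing A] [Algebra ℝ A]
    (L : A →ₗ[ℝ] ℝ) (hL1 : L 1 = 1)
    (K : Set (Moment.CharSpace A)) (hK : IsClosed K)
    (hpos : ∀ a ∈ Moment.Pos K, 0 ≤ L a) :
    -- representing measures on the finitely generated subalgebras
    (∀ S : Moment.FinGen A, ∃ μS : Measure (Moment.CharSpace S.1),
      Moment.IsRepresentingRadon (Moment.restrictFunctional L S.1)
        (closure (Moment.restrict S.1 '' K)) μS) ∧
    -- representing measures on the cylinder σ-algebra
    ((∃ μ : Measure[Moment.sigmaCyl A] (Moment.CharSpace A),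
        Moment.IsRepresenting L Set.univ μ ∧
        ∀ S : Moment.FinGen A,
          μ (Moment.restrict S.1 ⁻¹' closure (Moment.restrict S.1 '' K))ᶜ = 0) ↔
      ∃ μI : (S : Moment.FinGen A) → Measure (Moment.CharSpace S.1),
        (∀ S, Moment.IsRepresentingRadon (Moment.restrictFunctional L S.1)
          (closure (Moment.restrict S.1 '' K)) (μI S)) ∧
        Moment.IsExact μI ∧
        ∃ μΛ : (T : Moment.CountGen A) → Measure (Moment.CharSpace T.1),
          Moment.Corresponds μI μΛ ∧ Moment.IsExact μΛ ∧ Moment.IsThick μΛ) ∧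
    -- the case of a countably generated quadratic module
    (∀ Q G : Set A, G.Countable → Moment.IsGeneratedBy Q G → K = Moment.nonnegSet Q →
      ∀ μ : Measure[Moment.sigmaCyl A] (Moment.CharSpace A),
        Moment.IsRepresenting L Set.univ μ →
        (∀ S : Moment.FinGen A,
          μ (Moment.restrict S.1 ⁻¹' closure (Moment.restrict S.1 '' K))ᶜ = 0) →
        Moment.IsRepresenting L K μ) ∧
    -- representing Radon measures
    ((∃ ν : Measure (Moment.CharSpace A), Moment.IsRepresentingRadon L K ν) ↔
      ∃ μI : (S : Moment.FinGen A) → Measure (Moment.CharSpace S.1),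
        (∀ S, Moment.IsRepresentingRadon (Moment.restrictFunctional L S.1)
          (closure (Moment.restrict S.1 '' K)) (μI S)) ∧
        Moment.Prokhorov μI) := by
  refine ⟨Moment.exists_representing_finGen L hpos, ⟨?_, ?_⟩, ?_, ⟨?_, ?_⟩⟩
  · rintro ⟨μ, hμ, hsupp⟩
    have := hμ.isProbabilityMeasure hL1
    -- Here `Ω` is `X(A)` with the cylinder σ-algebra, passed explicitly because the default
    -- instance is the Borel one.
    exact @Moment.exists_thick_system A _ _ _ (Moment.sigmaCyl A) μ id this
      Moment.measurable_gelfand_sigmaCyl L hμ.integrable hμ.eq_integral K hsupp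
  · rintro ⟨μI, hrep, -, μΛ, hcorr, hexact, hthick⟩
    exact Moment.exists_representing_of_isThick hrep hcorr hexact hthick
  · intro Q G hG hQG hKQ μ hμ hsupp
    obtain rfl : K = Moment.nonnegSet G := hKQ.trans (Moment.nonnegSet_eq_of_isGeneratedBy hQG)
    exact Moment.isRepresenting_nonnegSet hG hμ hsupp
  · rintro ⟨ν, hν⟩
    exact Moment.exists_prokhorov_system hL1 hν
  · rintro ⟨μI, hrep, hprok⟩
    exact Moment.exists_representing_of_prokhorov hL1 hK hrep hprok
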